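/- **Theorem 1.** Let $N\ge 1$ and $H\ge 0$ be integers, $q_i>0$, $r_i>0$ for $1\le i\le N$, and let $\tau_i\ge 1$ be integers for $1\le i\le N-1$. Consider the problem $$\min_{z,u,v}\ \sum_{t=0}^{\infty}\sum_{i=1}^N\big(q_i z_i[t]^2+r_i v_i[t]^2\big)$$ subject to, for $1\le i\le N$ and $t\ge 0$, $$z_i[t+1]=z_i[t]-u_{i-1}[t]+u_i[t-\tau_i]+v_i[t]+d_i[t],$$ where $u_0=u_N=0$ identically, and where the initial levels $z_i[0]\in\mathbb R$ ($1\le i\le N$), the quantities in transit $u_i[t]\in\mathbb R$ ($1\le i\le N-1$, $-\tau_i\le t<0$) and the planned disturbances $d_i[t]\in\mathbb R$ are given. Let $\sigma_k=\sum_{i=1}^{k-1}\tau_i$ and $D_i[t]=\sum_{j=1}^i d_j[t-\sigma_j]$, and assume that $d_i[t]=0$ for all $1\le i\le N$ and all $t>H+(\sigma_N-\sigma_i)$. *Parameters (three sweeps).* From here on put $\tau_N=H+1$. Empty products are $1$. (1) $\gamma_1=q_1$, $\rho_1=r_1$, and for $i=2,\dots,N$: $\gamma_i=\frac{\gamma_{i-1}q_i}{\gamma_{i-1}+q_i}$,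 $\rho_i=\frac{\rho_{i-1}r_i}{\rho_{i-1}+r_i}$. (2) $X_N(H+2)=-\frac{\gamma_N}{2}+\sqrt{\gamma_N\rho_N+\frac{\gamma_N^2}{4}}$, and for $i=N,\dots,1$: $X_i(\tau_i)=\frac{\rho_i(X_{i+1}(1)+\gamma_i)}{X_{i+1}(1)+\gamma_i+\rho_i}$ if $i<N$; $X_i(t-1)=\frac{\rho_i(X_i(t)+\gamma_i)}{X_i(t)+\gamma_i+\rho_i}$ for $2\le t\le\tau_i$ (for $2\le t\le H+2$ if $i=N$); $g_i(j)=\frac{X_i(j)}{X_i(j)+\gamma_i}$ for $2\le j\le\tau_i$; for $i<N$, $g_{i+1}(1)=\frac{X_{i+1}(1)}{X_{i+1}(1)+\gamma_i}$ and $b_i=g_{i+1}(1)\prod_{j=2}^{\tau_i}g_i(j)$ ($b_N$ multiplies $\mu_{N+1}[t]=0$ below and is irrelevant); and for $1\le l,m\le\tau_i$: $P_i(1,m)=\frac{X_i(1)}{\rho_i}$ and, for $l\ge2$, $P_i(l,m)=\big(1-\frac{X_i(l)}{\rho_i}\big)\,\theta\,P_i(l-1,m)+\frac{X_i(l)}{\rho_i}$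 with $\theta=g_i(l)$ if $l\le m$ and $\theta=1$ if $l>m$. (3) $h_0=0$ and $h_i=(1-P_i(\tau_i,1))\,b_i\,h_{i-1}+P_i(\tau_i,\tau_i)\,g_{i+1}(1)$ for $1\le i\le N-1$. Finally, for $1\le i\le N$ and $1\le\Delta\le\tau_i$, $$\phi_i(\Delta)=1-P_i(\tau_i,\Delta)-(1-P_i(\tau_i,1))\,h_{i-1}\prod_{j=2}^{\Delta}g_i(j),\qquad a_i=\tfrac{X_i(1)}{r_i}+\tfrac{\gamma_i}{q_i}\Big(1-\tfrac{X_i(1)}{\rho_i}\Big),$$ $$c_i=-\Big(\tfrac{X_i(1)}{r_i}-\tfrac{\gamma_iX_i(1)}{q_i\rho_i}\Big)(1-h_{i-1})+\tfrac{\gamma_i}{q_i}h_{i-1}.$$ *Distributed controller (two sweeps, at each time $t\ge0$).* With $\delta_0[t]=0$ and $\mu_{N+1}[t]=0$: upstream, for $i=1,\dots,N$: $\Phi_i[t]=\phi_i(1)z_i[t]+\sum_{\Delta=0}^{\tau_i-1}\phi_i(\Delta+1)\big(u_i[t-(\tau_i-\Delta)]+D_i[t+\sigma_i+\Delta]\big)$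 and $\delta_i[t]=\Phi_i[t]+(1-P_i(\tau_i,1))\,\delta_{i-1}[t]$; downstream, for $i=N,\dots,1$: $\pi_i[t]=z_i[t]+\sum_{\Delta=0}^{\tau_i-1}\big(u_i[t-(\tau_i-\Delta)]+D_i[t+\sigma_i+\Delta]\big)\prod_{j=2}^{\Delta+1}g_i(j)$ and $\mu_i[t]=\pi_i[t]+b_i\,\mu_{i+1}[t]$; outputs, for $1\le i\le N$: $$u_{i-1}[t]=\Big(1-\frac{\gamma_i}{q_i}\Big)\big(z_i[t]+u_i[t-\tau_i]+D_i[t+\sigma_i]\big)-a_i\delta_{i-1}[t]+c_i\mu_i[t]+d_i[t]-D_i[t+\sigma_i],$$ $$v_i[t]=-\frac{X_i(1)}{r_i}\Big(\delta_{i-1}[t]+(1-h_{i-1})\mu_i[t]\Big).$$ Thus node $i$ uses only its own parameters and data, $\delta_{i-1}[t]$ received from node $i-1$, and $\mu_{i+1}[t]$ received from node $i+1$. *Conclusion.* The problem has an optimal solution, with finite cost, and a feasible $(z,u,v)$ is optimal if and only if at every time $t\ge 0$ all the inputs $u_{i-1}[t]$ and $v_i[t]$, $1\le i\le N$, are those produced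 by the distributed controller. -/

import Mathlib

namespace TransportLQ

noncomputable section

/-! ### The transportation problem on a directed path -/

/-- Data of the problem: `N` nodes `1, …, N`, level weights `q i`, production weights `r i`,
delays `τ i` of the link from node `i + 1` to node `i` (`1 ≤ i < N`), and the length `H` of the
horizon of planned disturbances.  Values at indices outside these ranges play no role. -/
structure Network where
  N : ℕ
  q : ℕ → ℝ
  r : ℕ → ℝ
  τ : ℕ → ℕ
  H : ℕ

/-- Node levels `z i t`, flows `u i t` (sent from node `i + 1` at time `t`, arriving in node `i` at
time `t + τ i`), and productions `v i t`. -/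
structure Trajectory where
  z : ℕ → ℤ → ℝ
  u : ℕ → ℤ → ℝ
  v : ℕ → ℤ → ℝ

namespace Network

variable (net : Network)

/-- Aggregate delay `σ_k = τ_1 + ⋯ + τ_{k-1}`. -/
def σ (k : ℕ) : ℕ := ∑ i ∈ Finset.Ico 1 k, net.τ i

/-- Shifted disturbance `D_i[t] = ∑_{j=1}^{i} d_j[t - σ_j]`. -/
def D (d : ℕ → ℤ → ℝ) (i : ℕ) (t : ℤ) : ℝ :=
  ∑ j ∈ Finset.Icc 1 i, d j (t - net.σ j)

/-- The trajectory satisfies the dynamics for planned disturbances `d`, starts from the levels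
`z₀` at time `0` with the quantities `u₀` in transit, and there is no flow out of node `1` to a
further node nor into node `N` from a further node. -/
structure IsFeasible (d : ℕ → ℤ → ℝ) (z₀ : ℕ → ℝ) (u₀ : ℕ → ℤ → ℝ) (w : Trajectory) : Prop where
  level_init : ∀ i, 1 ≤ i → i ≤ net.N → w.z i 0 = z₀ i
  transit_init : ∀ i, 1 ≤ i → i < net.N → ∀ t : ℤ, -(net.τ i : ℤ) ≤ t → t < 0 → w.u i t = u₀ i t
  no_flow_zero : ∀ t : ℤ, w.u 0 t = 0
  no_flow_last : ∀ t : ℤ, w.u net.N t = 0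
  dynamics : ∀ i, 1 ≤ i → i ≤ net.N → ∀ t : ℤ, 0 ≤ t →
    w.z i (t + 1) = w.z i t - w.u (i - 1) t + w.u i (t - net.τ i) + w.v i t + d i t

/-- The infinite-horizon cost, possibly infinite. -/
def cost (w : Trajectory) : ENNReal :=
  ∑' t : ℕ, ENNReal.ofReal
    (∑ i ∈ Finset.Icc 1 net.N, (net.q i * w.z i t ^ 2 + net.r i * w.v i t ^ 2))

/-- A feasible trajectory of minimal cost. -/
def IsOptimal (d : ℕ → ℤ → ℝ) (z₀ : ℕ → ℝ) (u₀ : ℕ → ℤ → ℝ) (w : Trajectory) : Prop :=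
  net.IsFeasible d z₀ u₀ w ∧ ∀ w', net.IsFeasible d z₀ u₀ w' → net.cost w ≤ net.cost w'

/-! ### Computation of the control parameters (three sweeps) -/

/-- The convention `τ_N = H + 1` of the algorithms. -/
def τ' (i : ℕ) : ℕ := if i = net.N then net.H + 1 else net.τ i

/-- First sweep, levels: `γ_1 = q_1`, `γ_i = γ_{i-1} q_i / (γ_{i-1} + q_i)`. -/
def γ : ℕ → ℝ
  | 0 => 0
  | 1 => net.q 1
  | i + 2 => γ (i + 1) * net.q (i + 2) / (γ (i + 1) + net.q (i + 2))

/-- First sweep, productions: `ρ_1 = r_1`, `ρ_i = ρ_{i-1} r_i / (ρ_{i-1} + r_i)`. -/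
def ρ : ℕ → ℝ
  | 0 => 0
  | 1 => net.r 1
  | i + 2 => ρ (i + 1) * net.r (i + 2) / (ρ (i + 1) + net.r (i + 2))

/-- One step `x ↦ ρ_i (x + γ_i) / (x + γ_i + ρ_i)` of the second sweep in node `i`. -/
def riccatiStep (i : ℕ) (x : ℝ) : ℝ := net.ρ i * (x + net.γ i) / (x + net.γ i + net.ρ i)

/-- Second sweep: `X_N(H+2)` is explicit, `X_i(τ_i)` for `i < N` is obtained from `X_{i+1}(1)`,
and `X_i(t)` from `X_i(t+1)` otherwise. -/
def X (i t : ℕ) : ℝ :=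
  if net.N < i then 0
  else if i = net.N then
    if net.H + 2 ≤ t then
      -(net.γ i / 2) + Real.sqrt (net.γ i * net.ρ i + net.γ i ^ 2 / 4)
    else net.riccatiStep i (X i (t + 1))
  else if net.τ i ≤ t then net.riccatiStep i (X (i + 1) 1)
  else net.riccatiStep i (X i (t + 1))
termination_by (net.N + 1 - i, net.H + 2 + net.τ i - t)

/-- `g_i(j) = X_i(j) / (X_i(j) + γ_i)` for `j ≥ 2`, and `g_i(1) = X_i(1) / (X_i(1) + γ_{i-1})`. -/
def g (i j : ℕ) : ℝ :=
  if j = 1 then net.X i 1 / (net.X i 1 + net.γ (i - 1))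
  else net.X i j / (net.X i j + net.γ i)

/-- `b_i = g_{i+1}(1) ∏_{j=2}^{τ_i} g_i(j)`. -/
def b (i : ℕ) : ℝ := net.g (i + 1) 1 * ∏ j ∈ Finset.Icc 2 (net.τ' i), net.g i j

/-- `P_i(l, m)`, by recursion on `l ≥ 1`. -/
def P (i : ℕ) : ℕ → ℕ → ℝ
  | 0, _ => 0
  | 1, _ => net.X i 1 / net.ρ i
  | l + 2, m =>
    if l + 2 ≤ m then
      (1 - net.X i (l + 2) / net.ρ i) * net.g i (l + 2) * P i (l + 1) m
        + net.X i (l + 2) / net.ρ i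
    else
      (1 - net.X i (l + 2) / net.ρ i) * P i (l + 1) m + net.X i (l + 2) / net.ρ i

/-- Third sweep, with `h_0 = 0`. -/
def h : ℕ → ℝ
  | 0 => 0
  | 1 => net.P 1 (net.τ' 1) (net.τ' 1) * net.g 2 1
  | i + 2 => (1 - net.P (i + 2) (net.τ' (i + 2)) 1) * net.b (i + 2) * h (i + 1)
      + net.P (i + 2) (net.τ' (i + 2)) (net.τ' (i + 2)) * net.g (i + 3) 1

/-- `φ_i(Δ)` for `1 ≤ Δ ≤ τ_i`. -/
def φ (i Δ : ℕ) : ℝ :=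
  1 - net.P i (net.τ' i) Δ
    - (1 - net.P i (net.τ' i) 1) * net.h (i - 1) * ∏ j ∈ Finset.Icc 2 Δ, net.g i j

def a (i : ℕ) : ℝ :=
  net.X i 1 / net.r i + net.γ i / net.q i * (1 - net.X i 1 / net.ρ i)

def c (i : ℕ) : ℝ :=
  -(net.X i 1 / net.r i - net.γ i * net.X i 1 / (net.q i * net.ρ i)) * (1 - net.h (i - 1))
    + net.γ i / net.q i * net.h (i - 1)

end Network

/-! ### The distributed controller (two sweeps)

The functions in this section take the parameters and the data of one single node, and the messages
received from its neighbours; this is what makes the controller distributed. -/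

/-- The parameters stored in node `i`; `p` is `P_i(τ_i, 1)`, `X₁` is `X_i(1)` and `hd` is `h_{i-1}`,
which was received from node `i - 1` in the third sweep. -/
structure NodeParams where
  τ : ℕ
  q : ℝ
  r : ℝ
  γ : ℝ
  X₁ : ℝ
  g : ℕ → ℝ
  b : ℝ
  p : ℝ
  hd : ℝ
  φ : ℕ → ℝ
  a : ℝ
  c : ℝ

/-- The data available in node `i` at time `t`: the level `z_i[t]`, the quantities in transit to the
node `transit Δ = u_i[t - (τ_i - Δ)]`, the disturbance `d_i[t]`, and the shifted disturbances
`shifted Δ = D_i[t + σ_i + Δ]`, where `0 ≤ Δ < τ_i`. -/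
structure NodeData where
  z : ℝ
  d : ℝ
  transit : ℕ → ℝ
  shifted : ℕ → ℝ

namespace NodeParams

variable (n : NodeParams) (s : NodeData)

/-- The local variable `Φ_i[t]`. -/
def Φ : ℝ :=
  n.φ 1 * s.z + ∑ Δ ∈ Finset.range n.τ, n.φ (Δ + 1) * (s.transit Δ + s.shifted Δ)

/-- The message `δ_i[t]` sent upstream, given the message `δ = δ_{i-1}[t]` from downstream. -/
def upMessage (δ : ℝ) : ℝ := n.Φ s + (1 - n.p) * δ

/-- The local variable `π_i[t]`. -/
def π : ℝ :=
  s.z + ∑ Δ ∈ Finset.range n.τ,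
    (s.transit Δ + s.shifted Δ) * ∏ j ∈ Finset.Icc 2 (Δ + 1), n.g j

/-- The message `μ_i[t]` sent downstream, given the message `μ = μ_{i+1}[t]` from upstream. -/
def downMessage (μ : ℝ) : ℝ := n.π s + n.b * μ

/-- The flow `u_{i-1}[t]` out of node `i`, given `δ = δ_{i-1}[t]` and `μ = μ_i[t]`. -/
def flow (δ μ : ℝ) : ℝ :=
  (1 - n.γ / n.q) * (s.z + s.transit 0 + s.shifted 0) - n.a * δ + n.c * μ + s.d - s.shifted 0

/-- The production `v_i[t]`, given `δ = δ_{i-1}[t]` and `μ = μ_i[t]`. -/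
def production (δ μ : ℝ) : ℝ := -(n.X₁ / n.r) * (δ + (1 - n.hd) * μ)

end NodeParams

namespace Network

variable (net : Network)

/-- The parameters of node `i` computed by the three sweeps. -/
def params (i : ℕ) : NodeParams where
  τ := net.τ' i
  q := net.q i
  r := net.r i
  γ := net.γ i
  X₁ := net.X i 1
  g := net.g i
  b := net.b i
  p := net.P i (net.τ' i) 1
  hd := net.h (i - 1)
  φ := net.φ i
  a := net.a i
  c := net.c i

/-- The data of node `i` at time `t` along a trajectory. -/
def data (d : ℕ → ℤ → ℝ) (w : Trajectory) (t : ℤ) (i : ℕ) : NodeData where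
  z := w.z i t
  d := d i t
  transit Δ := w.u i (t - ((net.τ' i : ℤ) - Δ))
  shifted Δ := net.D d i (t + net.σ i + Δ)

/-- Upstream sweep: `δ_i[t]`, with `δ_0[t] = 0`. -/
def δ (d : ℕ → ℤ → ℝ) (w : Trajectory) (t : ℤ) : ℕ → ℝ
  | 0 => 0
  | i + 1 => (net.params (i + 1)).upMessage (net.data d w t (i + 1)) (δ d w t i)

/-- Downstream sweep: `μ_i[t]`, with `μ_{N+1}[t] = 0`. -/
def μ (d : ℕ → ℤ → ℝ) (w : Trajectory) (t : ℤ) (i : ℕ) : ℝ :=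
  if net.N < i then 0
  else (net.params i).downMessage (net.data d w t i) (μ d w t (i + 1))
termination_by net.N + 1 - i

/-- At every time `t ≥ 0` all inputs of the trajectory are the outputs of the distributed
controller. -/
def IsControlled (d : ℕ → ℤ → ℝ) (w : Trajectory) : Prop :=
  ∀ t : ℤ, 0 ≤ t → ∀ i, 1 ≤ i → i ≤ net.N →
    w.u (i - 1) t
        = (net.params i).flow (net.data d w t i) (net.δ d w t (i - 1)) (net.μ d w t i) ∧
    w.v i t
        = (net.params i).production (net.δ d w t (i - 1)) (net.μ d w t i)

end Network

end

end TransportLQ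

/-! Necessity. An optimal trajectory of finite cost is stationary under two finitely supported
perturbations: postponing a unit of production, and relocating it along a link. In shifted time,
stationarity says that all nodes share one costate λ: r_i v_i[t] = -λ(t + σ_i), and q_i z_i[t+1] is
the decrement of λ there. Hence the total level m_k of nodes 1, …, k in shifted time obeys a scalar
linear-quadratic recursion whose weights are the parallel sums γ_k, ρ_k (`aggregate_dynamics`,
`aggregate_eq`).

Over the window of length τ_k starting at t + σ_k, the inflows of this recursion are planned
disturbances and goods already in transit at time t. The window of node k ends where that of node
k+1 starts, and there m_{k+1} = m_k + z_{k+1}[t]. After the last window nothing enters, and decay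
forces λ onto the stable Riccati solution (`costate_eq_of_horizon`). Sweeping back through the
windows gives λ = X (m_{i-1} + μ_i) at t + σ_i (`costate_node_start`); sweeping forward gives
m_{i-1} = δ_{i-1} - h_{i-1} μ_i (`aggregate_node_end`). Together they express λ, hence the inputs,
by data known at time t (`isControlled`).

Sufficiency needs no convexity: the controller determines levels and productions, so every
controlled feasible trajectory has the cost of an optimal one (`cost_eq_of_isControlled`). An
optimal one exists by the direct method (`exists_isOptimal`). -/

namespace TransportLQ

/-! ### Linear-quadratic recursions in a single node -/

/-- Eliminating l' gives l = (x' + γ) m' + x' f'; inserting m' leaves a linear equation for l, whose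
solution is the Riccati step. -/
theorem costate_step {ρ γ x x' m e m' l l' f' : ℝ} (hρ : 0 < ρ) (hγ : 0 < γ) (hx' : 0 < x')
    (hx : x = ρ * (x' + γ) / (x' + γ + ρ)) (hm : m' = m + e - l / ρ) (hl : γ * m' = l - l')
    (hl' : l' = x' * (m' + f')) : l = x * (m + (e + x' / (x' + γ) * f')) := by
  have h1 : x' + γ ≠ 0 := by positivity
  have h2 : x' + γ + ρ ≠ 0 := by positivity
  have key : l * (x' + γ + ρ) = ρ * ((x' + γ) * (m + e) + x' * f') := by
    have h3 : ρ * m' = ρ * (m + e) - l := by rw [hm]; field_simp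
    linear_combination (-ρ) * hl + ρ * hl' + (x' + γ) * h3
  rw [hx]
  field_simp
  linarith

section Node

variable {T : ℕ} {ρ γ f : ℝ} {x m e l : ℕ → ℝ}

theorem exists_feedforward (hρ : 0 < ρ) (hγ : 0 < γ)
    (hx : ∀ j, 1 ≤ j → j ≤ T + 1 → 0 < x j)
    (hstep : ∀ j, 1 ≤ j → j ≤ T → x j = ρ * (x (j + 1) + γ) / (x (j + 1) + γ + ρ))
    (hm : ∀ n < T, m (n + 1) = m n + e n - l n / ρ)
    (hl : ∀ n < T, γ * m (n + 1) = l n - l (n + 1))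
    (hT : l T = x (T + 1) * (m T + f)) :
    ∃ F : ℕ → ℝ, F T = f ∧ (∀ n ≤ T, l n = x (n + 1) * (m n + F n)) ∧
      ∀ n < T, F n = e n + x (n + 2) / (x (n + 2) + γ) * F (n + 1) := by
  have hF : ∀ n ≤ T, l n = x (n + 1) * (m n + (l n / x (n + 1) - m n)) := by
    intro n hn
    have := (hx (n + 1) (by omega) (by omega)).ne'
    field_simp
    ring
  -- The affine form forces this choice of F; its recursion is then `costate_step`.
  refine ⟨fun n => l n / x (n + 1) - m n, ?_, hF, ?_⟩
  · have := (hx (T + 1) (by omega) le_rfl).ne'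
    simp only [hT]
    field_simp
    ring
  · intro n hn
    have h0 := (hx (n + 1) (by omega) (by omega)).ne'
    have := costate_step hρ hγ (hx (n + 2) (by omega) (by omega))
      (hstep (n + 1) (by omega) (by omega)) (hm n hn) (hl n hn) (hF (n + 1) hn)
    simp only
    rw [sub_eq_iff_eq_add, div_eq_iff h0, this]
    ring

theorem feedforward_expansion {g F : ℕ → ℝ} (hF : ∀ n < T, F n = e n + g (n + 2) * F (n + 1))
    (n : ℕ) (hn : n ≤ T) :
    F 0 = ∑ Δ ∈ Finset.range n, e Δ * ∏ j ∈ Finset.Icc 2 (Δ + 1), g j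
      + (∏ j ∈ Finset.Icc 2 (n + 1), g j) * F n := by
  induction n with
  | zero => simp
  | succ n ih =>
    rw [ih (by omega), hF n hn, Finset.sum_range_succ,
      Finset.prod_Icc_succ_top (show 2 ≤ n + 1 + 1 by omega)]
    ring

/-- The closed loop is solved forward while the feedforward F (n + 1), which carries everything
still to arrive, is kept as a free variable. Thus 1 - P is the response of the level to an earlier
inflow, and the last term is the reaction to the future. -/
theorem level_expansion {g F : ℕ → ℝ} {P : ℕ → ℕ → ℝ}
    (hm : ∀ n < T, m (n + 1) = m n + e n - l n / ρ)
    (hl : ∀ n < T, l n = x (n + 1) * (m n + F n))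
    (hF : ∀ n < T, F n = e n + g (n + 2) * F (n + 1))
    (hP1 : ∀ k, P 1 k = x 1 / ρ)
    (hPle : ∀ n k, n + 2 ≤ T → n + 2 ≤ k → P (n + 2) k
      = (1 - x (n + 2) / ρ) * g (n + 2) * P (n + 1) k + x (n + 2) / ρ)
    (hPgt : ∀ n k, n + 2 ≤ T → k < n + 2 → P (n + 2) k
      = (1 - x (n + 2) / ρ) * P (n + 1) k + x (n + 2) / ρ) (n : ℕ) (hn : n + 1 ≤ T) :
    m (n + 1) = (1 - P (n + 1) 1) * m 0
      + ∑ Δ ∈ Finset.range (n + 1), (1 - P (n + 1) (Δ + 1)) * e Δ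
      - P (n + 1) (n + 1) * g (n + 2) * F (n + 1) := by
  -- Inflows that have not yet arrived act only through F, so they all share one coefficient.
  have hPconst : ∀ n, n + 1 ≤ T → ∀ k, n + 1 ≤ k → P (n + 1) k = P (n + 1) (n + 1) := by
    intro n
    induction n with
    | zero => intro _ k _; simp [hP1]
    | succ n ih =>
      intro hn k hk
      rw [hPle n k hn hk, hPle n (n + 1 + 1) hn le_rfl, ih (by omega) k (by omega),
        ih (by omega) (n + 1 + 1) (by omega)]
  induction n with
  | zero =>
    have h0 := hF 0 (by omega)
    rw [hm 0 (by omega), hl 0 (by omega), h0]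
    simp only [zero_add, hP1, Finset.sum_range_one]
    ring
  | succ n ih =>
    have h0 := hF (n + 1) (by omega)
    have hsum : ∑ Δ ∈ Finset.range (n + 1), (1 - P (n + 2) (Δ + 1)) * e Δ
        = (1 - x (n + 2) / ρ) * ∑ Δ ∈ Finset.range (n + 1), (1 - P (n + 1) (Δ + 1)) * e Δ := by
      rw [Finset.mul_sum]
      refine Finset.sum_congr rfl fun Δ hΔ => ?_
      have := Finset.mem_range.1 hΔ
      rw [hPgt n (Δ + 1) (by omega) (by omega)]
      ring
    rw [Finset.sum_range_succ, hsum, hm (n + 1) (by omega), hl (n + 1) (by omega),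
      hPgt n 1 (by omega) (by omega), hPle n (n + 2) (by omega) le_rfl,
      hPconst n (by omega) (n + 2) (by omega)]
    have h1 := ih (by omega)
    rw [h0] at h1 ⊢
    linear_combination (1 - x (n + 2) / ρ) * h1

end Node

/-- A linear recursion that expands has no non-zero solution tending to zero. -/
theorem eq_zero_of_expanding {y : ℕ → ℝ} {a : ℝ} (ha : 1 ≤ a) (hy : ∀ n, y (n + 1) = a * y n)
    (hlim : Filter.Tendsto y Filter.atTop (nhds 0)) : y 0 = 0 := by
  have hle : ∀ n, |y 0| ≤ |y n| := by
    intro n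
    induction n with
    | zero => rfl
    | succ n ih =>
      rw [hy, abs_mul]
      nlinarith [abs_nonneg (y n), le_abs_self a]
  simpa using ge_of_tendsto' hlim.abs hle

namespace Network

variable (net : Network)

/-! ### The parameters -/

theorem sum_inv_q (hq : ∀ i, 1 ≤ i → i ≤ net.N → 0 < net.q i) (k : ℕ) (hk : k + 1 ≤ net.N) :
    0 < net.γ (k + 1) ∧ (net.γ (k + 1))⁻¹ = ∑ j ∈ Finset.Icc 1 (k + 1), (net.q j)⁻¹ := by
  induction k with
  | zero => simpa [γ] using hq 1 le_rfl hk
  | succ k ih =>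
    obtain ⟨h1, h2⟩ := ih (by omega)
    have h3 := hq (k + 2) (by omega) hk
    rw [Finset.sum_Icc_succ_top (by omega), ← h2]
    simp only [γ]
    refine ⟨by positivity, ?_⟩
    field_simp
    ring

theorem sum_inv_r (hr : ∀ i, 1 ≤ i → i ≤ net.N → 0 < net.r i) (k : ℕ) (hk : k + 1 ≤ net.N) :
    0 < net.ρ (k + 1) ∧ (net.ρ (k + 1))⁻¹ = ∑ j ∈ Finset.Icc 1 (k + 1), (net.r j)⁻¹ := by
  induction k with
  | zero => simpa [ρ] using hr 1 le_rfl hk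
  | succ k ih =>
    obtain ⟨h1, h2⟩ := ih (by omega)
    have h3 := hr (k + 2) (by omega) hk
    rw [Finset.sum_Icc_succ_top (by omega), ← h2]
    simp only [ρ]
    refine ⟨by positivity, ?_⟩
    field_simp
    ring

theorem γ_pos (hq : ∀ i, 1 ≤ i → i ≤ net.N → 0 < net.q i) {i : ℕ} (h1 : 1 ≤ i)
    (hi : i ≤ net.N) : 0 < net.γ i := by
  obtain ⟨k, rfl⟩ := Nat.exists_eq_add_of_le' h1
  exact (net.sum_inv_q hq k hi).1

theorem ρ_pos (hr : ∀ i, 1 ≤ i → i ≤ net.N → 0 < net.r i) {i : ℕ} (h1 : 1 ≤ i)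
    (hi : i ≤ net.N) : 0 < net.ρ i := by
  obtain ⟨k, rfl⟩ := Nat.exists_eq_add_of_le' h1
  exact (net.sum_inv_r hr k hi).1

theorem τ'_pos (hτ : ∀ i, 1 ≤ i → i < net.N → 1 ≤ net.τ i) {i : ℕ} (h1 : 1 ≤ i)
    (hi : i ≤ net.N) : 1 ≤ net.τ' i := by
  unfold τ'
  split_ifs with h
  · omega
  · exact hτ i h1 (by omega)

theorem X_pos (hq : ∀ i, 1 ≤ i → i ≤ net.N → 0 < net.q i)
    (hr : ∀ i, 1 ≤ i → i ≤ net.N → 0 < net.r i) (i t : ℕ) (h1 : 1 ≤ i) (hi : i ≤ net.N) :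
    0 < net.X i t := by
  have hγ := net.γ_pos hq h1 hi
  have hρ := net.ρ_pos hr h1 hi
  have hstep : ∀ x, 0 < x → 0 < net.riccatiStep i x := fun x hx => by
    unfold riccatiStep
    positivity
  rw [X, if_neg (by omega)]
  split_ifs with hN ht ht
  · have : net.γ i / 2 < Real.sqrt (net.γ i * net.ρ i + net.γ i ^ 2 / 4) := by
      apply Real.lt_sqrt_of_sq_lt
      nlinarith [mul_pos hγ hρ]
    linarith
  · exact hstep _ (X_pos hq hr i (t + 1) h1 hi)
  · exact hstep _ (X_pos hq hr (i + 1) 1 (by omega) (by omega))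
  · exact hstep _ (X_pos hq hr i (t + 1) h1 hi)
termination_by (net.N + 1 - i, net.H + 2 + net.τ i - t)

/-- The coefficients of the cost-to-go in node `i`, continued beyond `τ_i`. -/
noncomputable def costToGo (i j : ℕ) : ℝ :=
  if i < net.N ∧ net.τ i < j then net.X (i + 1) 1 else net.X i j

theorem costToGo_pos (hq : ∀ i, 1 ≤ i → i ≤ net.N → 0 < net.q i)
    (hr : ∀ i, 1 ≤ i → i ≤ net.N → 0 < net.r i) {i : ℕ} (j : ℕ) (h1 : 1 ≤ i) (hi : i ≤ net.N) :
    0 < net.costToGo i j := by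
  unfold costToGo
  split_ifs with h
  · exact net.X_pos hq hr _ _ (by omega) (by omega)
  · exact net.X_pos hq hr _ _ h1 hi

theorem costToGo_of_le {i j : ℕ} (hj : j ≤ net.τ' i) : net.costToGo i j = net.X i j := by
  unfold costToGo
  unfold τ' at hj
  rw [if_neg]
  rintro ⟨h1, h2⟩
  rw [if_neg (by omega)] at hj
  omega

theorem costToGo_last : net.costToGo net.N (net.H + 2)
    = -(net.γ net.N / 2) + Real.sqrt (net.γ net.N * net.ρ net.N + net.γ net.N ^ 2 / 4) := by
  rw [costToGo, if_neg (by omega), X]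
  simp

theorem costToGo_succ {i : ℕ} (hi : i < net.N) :
    net.costToGo i (net.τ' i + 1) = net.X (i + 1) 1 := by
  unfold costToGo τ'
  rw [if_pos]
  simp [hi, hi.ne]

/-- Continuing X_i past τ_i by X_{i+1}(1) turns the cases of the second sweep into one recursion,
valid up to the end of the window. -/
theorem costToGo_step {i j : ℕ} (hi : i ≤ net.N) (hj : j ≤ net.τ' i) :
    net.costToGo i j = net.ρ i * (net.costToGo i (j + 1) + net.γ i)
      / (net.costToGo i (j + 1) + net.γ i + net.ρ i) := by
  rw [net.costToGo_of_le hj, X, if_neg (by omega)]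
  unfold τ' at hj
  unfold costToGo
  split_ifs at hj ⊢ with h1 h2 h3 h4 h5 <;> first | rfl | omega

theorem g_eq {i j : ℕ} (h2 : 2 ≤ j) (hj : j ≤ net.τ' i) :
    net.g i j = net.costToGo i j / (net.costToGo i j + net.γ i) := by
  rw [net.costToGo_of_le hj, g, if_neg (by omega)]

/-- This gain belongs to the last step inside window i, which is why its weight is γ_i and not
γ_{i+1}. -/
theorem g_succ_one {i : ℕ} (hi : i < net.N) :
    net.g (i + 1) 1 = net.costToGo i (net.τ' i + 1)
      / (net.costToGo i (net.τ' i + 1) + net.γ i) := by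
  rw [net.costToGo_succ hi, g, if_pos rfl, Nat.add_sub_cancel]

theorem h_eq {i : ℕ} (h1 : 1 ≤ i) :
    net.h i = (1 - net.P i (net.τ' i) 1) * net.b i * net.h (i - 1)
      + net.P i (net.τ' i) (net.τ' i) * net.g (i + 1) 1 := by
  match i, h1 with
  | 1, _ => simp [h]
  | i + 2, _ => rfl

theorem costToGo_stationary (hq : ∀ i, 1 ≤ i → i ≤ net.N → 0 < net.q i)
    (hr : ∀ i, 1 ≤ i → i ≤ net.N → 0 < net.r i) (hN : 1 ≤ net.N) :
    net.costToGo net.N (net.H + 2) ^ 2 + net.γ net.N * net.costToGo net.N (net.H + 2)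
      = net.γ net.N * net.ρ net.N := by
  have hγ := net.γ_pos hq hN le_rfl
  have hρ := net.ρ_pos hr hN le_rfl
  have := Real.sq_sqrt (show 0 ≤ net.γ net.N * net.ρ net.N + net.γ net.N ^ 2 / 4 by positivity)
  rw [costToGo_last]
  linear_combination this

open Filter Topology

/-! ### Stationarity conditions -/

/-- The discrete Euler–Lagrange equations, together with decay of levels and productions. -/
structure IsExtremal (d : ℕ → ℤ → ℝ) (w : Trajectory) : Prop where
  no_flow_zero : ∀ t : ℤ, w.u 0 t = 0
  no_flow_last : ∀ t : ℤ, w.u net.N t = 0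
  dynamics : ∀ i, 1 ≤ i → i ≤ net.N → ∀ t : ℤ, 0 ≤ t →
    w.z i (t + 1) = w.z i t - w.u (i - 1) t + w.u i (t - net.τ i) + w.v i t + d i t
  postpone : ∀ i, 1 ≤ i → i ≤ net.N → ∀ t : ℤ, 0 ≤ t →
    net.r i * w.v i (t + 1) = net.r i * w.v i t + net.q i * w.z i (t + 1)
  relocate : ∀ i, 1 ≤ i → i < net.N → ∀ t : ℤ, 0 ≤ t →
    net.r (i + 1) * w.v (i + 1) t = net.r i * w.v i (t + net.τ i)
  tendsto_z : ∀ i, 1 ≤ i → i ≤ net.N → Tendsto (fun t : ℕ => w.z i t) atTop (𝓝 0)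
  tendsto_v : ∀ i, 1 ≤ i → i ≤ net.N → Tendsto (fun t : ℕ => w.v i t) atTop (𝓝 0)

/-- Total level of the nodes `1, …, k` in shifted time. -/
noncomputable def aggregate (w : Trajectory) (k : ℕ) (s : ℤ) : ℝ :=
  ∑ j ∈ Finset.Icc 1 k, w.z j (s - net.σ j)

/-- The multiplier of the conservation law in shifted time. -/
def costate (w : Trajectory) (s : ℤ) : ℝ := -(net.r 1 * w.v 1 s)

theorem σ_one : net.σ 1 = 0 := by simp [σ]

theorem σ_succ {k : ℕ} (hk : 1 ≤ k) : net.σ (k + 1) = net.σ k + net.τ k :=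
  Finset.sum_Ico_succ_top hk _

theorem σ_mono : Monotone net.σ := fun _ _ h =>
  Finset.sum_le_sum_of_subset (Finset.Ico_subset_Ico le_rfl h)

theorem aggregate_succ (w : Trajectory) (k : ℕ) (s : ℤ) :
    net.aggregate w (k + 1) s = net.aggregate w k s + w.z (k + 1) (s - net.σ (k + 1)) :=
  Finset.sum_Icc_succ_top (by omega) _

/-! ### Extremals in shifted time: costate and aggregate levels -/

namespace IsExtremal

variable {net} {d : ℕ → ℤ → ℝ} {w : Trajectory}

theorem production_eq (hw : net.IsExtremal d w) {i : ℕ} (h1 : 1 ≤ i) (hi : i ≤ net.N) {t : ℤ}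
    (ht : 0 ≤ t) : net.r i * w.v i t = -net.costate w (t + net.σ i) := by
  induction i, h1 using Nat.le_induction generalizing t with
  | base => simp [costate, σ_one]
  | succ k hk ih =>
    rw [hw.relocate k hk (by omega) t ht, ih (by omega) (by omega), net.σ_succ hk]
    congr 2
    push_cast
    ring

theorem level_eq (hw : net.IsExtremal d w) {i : ℕ} (h1 : 1 ≤ i) (hi : i ≤ net.N) {t : ℤ}
    (ht : 0 ≤ t) :
    net.q i * w.z i (t + 1) = net.costate w (t + net.σ i) - net.costate w (t + net.σ i + 1) := by
  have := hw.postpone i h1 hi t ht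
  rw [hw.production_eq h1 hi ht, hw.production_eq h1 hi (by omega)] at this
  rw [show t + net.σ i + 1 = t + 1 + net.σ i by ring]
  linarith

/-- Since σ_{j+1} = σ_j + τ_j, the flow leaving node j+1 and its arrival in node j fall on the same
shifted time. The flows telescope and only the inflow from node k+1 survives. -/
theorem aggregate_dynamics (hw : net.IsExtremal d w)
    (hr : ∀ i, 1 ≤ i → i ≤ net.N → 0 < net.r i) {k : ℕ} (h1 : 1 ≤ k) (hk : k ≤ net.N) {s : ℤ}
    (hs : (net.σ k : ℤ) ≤ s) :
    net.aggregate w k (s + 1) = net.aggregate w k s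
      + (w.u k (s - net.σ k - net.τ k) + net.D d k s) - net.costate w s / net.ρ k := by
  have key : ∀ k, 1 ≤ k → k ≤ net.N → (net.σ k : ℤ) ≤ s →
      net.aggregate w k (s + 1) = net.aggregate w k s
      + (w.u k (s - net.σ k - net.τ k) + net.D d k s)
      - net.costate w s * ∑ j ∈ Finset.Icc 1 k, (net.r j)⁻¹ := by
    intro k h1
    have hstep : ∀ i, 1 ≤ i → i ≤ net.N → (net.σ i : ℤ) ≤ s →
        w.z i (s + 1 - net.σ i) = w.z i (s - net.σ i) - w.u (i - 1) (s - net.σ i)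
          + w.u i (s - net.σ i - net.τ i) - net.costate w s * (net.r i)⁻¹
          + d i (s - net.σ i) := by
      intro i h1 hi hs
      have h2 := hw.dynamics i h1 hi (s - net.σ i) (by omega)
      have h3 := hw.production_eq h1 hi (t := s - net.σ i) (by omega)
      have h4 := (hr i h1 hi).ne'
      rw [show s - net.σ i + net.σ i = s by ring] at h3
      rw [show s + 1 - net.σ i = s - net.σ i + 1 by ring, h2,
        show w.v i (s - net.σ i) = -(net.costate w s * (net.r i)⁻¹) by field_simp; linarith]
      ring
    induction k, h1 using Nat.le_induction with
    | base =>
      intro hk hs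
      have := hstep 1 le_rfl hk hs
      simp only [aggregate, D, Finset.Icc_self, Finset.sum_singleton]
      rw [this, Nat.sub_self, hw.no_flow_zero]
      ring
    | succ k hk ih =>
      intro hk' hs
      have h2 := hstep (k + 1) (by omega) hk' hs
      have h3 := net.σ_succ hk
      have h4 := ih (by omega) (by omega)
      have h5 : net.D d (k + 1) s = net.D d k s + d (k + 1) (s - net.σ (k + 1)) :=
        Finset.sum_Icc_succ_top (by omega) _
      rw [aggregate_succ, aggregate_succ, h2, h4, Finset.sum_Icc_succ_top (by omega), h5,
        Nat.add_sub_cancel, show s - net.σ k - net.τ k = s - net.σ (k + 1) by rw [h3]; push_cast; ring]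
      ring
  obtain ⟨k, rfl⟩ := Nat.exists_eq_add_of_le' h1
  rw [key _ h1 hk hs, ← (net.sum_inv_r hr k hk).2, div_eq_mul_inv]

theorem aggregate_eq (hw : net.IsExtremal d w)
    (hq : ∀ i, 1 ≤ i → i ≤ net.N → 0 < net.q i) {k : ℕ} (h1 : 1 ≤ k) (hk : k ≤ net.N) {s : ℤ}
    (hs : (net.σ k : ℤ) ≤ s) :
    net.γ k * net.aggregate w k (s + 1) = net.costate w s - net.costate w (s + 1) := by
  have key : net.aggregate w k (s + 1)
      = (net.costate w s - net.costate w (s + 1)) * ∑ j ∈ Finset.Icc 1 k, (net.q j)⁻¹ := by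
    rw [aggregate, Finset.mul_sum]
    refine Finset.sum_congr rfl fun j hj => ?_
    obtain ⟨hj1, hj2⟩ := Finset.mem_Icc.1 hj
    have h2 := net.σ_mono hj2
    have h3 := hw.level_eq hj1 (by omega) (t := s - net.σ j) (by omega)
    have h4 := (hq j hj1 (by omega)).ne'
    rw [show s - net.σ j + net.σ j = s by ring] at h3
    rw [show s + 1 - net.σ j = s - net.σ j + 1 by ring]
    field_simp
    linarith
  obtain ⟨k, rfl⟩ := Nat.exists_eq_add_of_le' h1
  obtain ⟨h2, h3⟩ := net.sum_inv_q hq k hk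
  rw [key, ← h3]
  field_simp

theorem tendsto_aggregate (hw : net.IsExtremal d w) {k : ℕ} (hk : k ≤ net.N) {s : ℤ} :
    Tendsto (fun n : ℕ => net.aggregate w k (s + n)) atTop (𝓝 0) := by
  have : Tendsto (fun n : ℕ => net.aggregate w k (s + n)) atTop
      (𝓝 (∑ j ∈ Finset.Icc 1 k, (0 : ℝ))) := by
    refine tendsto_finsetSum _ fun j hj => ?_
    obtain ⟨hj1, hj2⟩ := Finset.mem_Icc.1 hj
    have h1 := hw.tendsto_z j hj1 (by omega)
    have h2 : Tendsto (fun n : ℕ => (s + n - net.σ j).toNat) atTop atTop := by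
      refine tendsto_atTop.2 fun b => ?_
      filter_upwards [eventually_ge_atTop (b + s.natAbs + net.σ j)] with n hn
      omega
    refine (h1.comp h2).congr' ?_
    filter_upwards [eventually_ge_atTop (s.natAbs + net.σ j)] with n hn
    simp only [Function.comp]
    congr 1
    omega
  simpa using this

theorem tendsto_costate (hw : net.IsExtremal d w) (hN : 1 ≤ net.N) {s : ℤ} :
    Tendsto (fun n : ℕ => net.costate w (s + n)) atTop (𝓝 0) := by
  have h1 := hw.tendsto_v 1 le_rfl hN
  have h2 : Tendsto (fun n : ℕ => (s + n).toNat) atTop atTop := by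
    refine tendsto_atTop.2 fun b => ?_
    filter_upwards [eventually_ge_atTop (b + s.natAbs)] with n hn
    omega
  have h3 : Tendsto (fun n : ℕ => w.v 1 (s + n)) atTop (𝓝 0) := by
    refine (h1.comp h2).congr' ?_
    filter_upwards [eventually_ge_atTop s.natAbs] with n hn
    simp only [Function.comp]
    congr 1
    omega
  simpa [costate] using (h3.const_mul (net.r 1)).neg

theorem D_eq_zero (hd : ∀ i, 1 ≤ i → i ≤ net.N → ∀ t : ℤ,
      (net.H : ℤ) + ((net.σ net.N : ℤ) - (net.σ i : ℤ)) < t → d i t = 0) {s : ℤ}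
    (hs : (net.σ net.N : ℤ) + net.H < s) : net.D d net.N s = 0 := by
  refine Finset.sum_eq_zero fun j hj => ?_
  obtain ⟨hj1, hj2⟩ := Finset.mem_Icc.1 hj
  exact hd j hj1 hj2 _ (by omega)

/-- After the horizon the costate is on the stable manifold of the Riccati equation. -/
theorem costate_eq_of_horizon (hw : net.IsExtremal d w) (hN : 1 ≤ net.N)
    (hq : ∀ i, 1 ≤ i → i ≤ net.N → 0 < net.q i)
    (hr : ∀ i, 1 ≤ i → i ≤ net.N → 0 < net.r i)
    (hd : ∀ i, 1 ≤ i → i ≤ net.N → ∀ t : ℤ,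
      (net.H : ℤ) + ((net.σ net.N : ℤ) - (net.σ i : ℤ)) < t → d i t = 0) {s : ℤ}
    (hs : (net.σ net.N : ℤ) + net.H < s) :
    net.costate w s = net.costToGo net.N (net.H + 2) * net.aggregate w net.N s := by
  have hγ := net.γ_pos hq hN le_rfl
  have hρ := net.ρ_pos hr hN le_rfl
  have hX := net.costToGo_pos hq hr (net.H + 2) hN le_rfl
  have hst := net.costToGo_stationary hq hr hN
  set x := net.costToGo net.N (net.H + 2)
  -- The deviation from the stable solution is the other mode of the recursion; its factor exceeds
  -- 1, so decay excludes it.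
  have h0 := eq_zero_of_expanding (a := 1 + (net.γ net.N + x) / net.ρ net.N)
    (y := fun n => net.costate w (s + n) - x * net.aggregate w net.N (s + n))
    (le_add_of_nonneg_right (by positivity)) ?_ ?_
  · simp only [Nat.cast_zero, add_zero] at h0
    linarith
  · intro n
    have h1 := hw.aggregate_dynamics hr hN le_rfl (s := s + n) (by omega)
    have h2 := hw.aggregate_eq hq hN le_rfl (s := s + n) (by omega)
    rw [hw.no_flow_last, D_eq_zero hd (by omega)] at h1
    push_cast
    rw [← add_assoc]
    have h3 : net.ρ net.N * net.aggregate w net.N (s + n + 1)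
        = net.ρ net.N * net.aggregate w net.N (s + n) - net.costate w (s + n) := by
      rw [h1]; field_simp; ring
    have h4 : net.ρ net.N * (1 + (net.γ net.N + x) / net.ρ net.N) = net.ρ net.N + net.γ net.N + x := by
      field_simp; ring
    apply mul_left_cancel₀ hρ.ne'
    rw [← mul_assoc, h4]
    linear_combination net.ρ net.N * h2 - (net.γ net.N + x) * h3
      + net.aggregate w net.N (s + n) * hst
  · simpa using (hw.tendsto_costate hN).sub ((hw.tendsto_aggregate le_rfl).const_mul x)

/-- The recursions of a single node along an extremal. -/
theorem node_recursion (hw : net.IsExtremal d w)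
    (hq : ∀ i, 1 ≤ i → i ≤ net.N → 0 < net.q i)
    (hr : ∀ i, 1 ≤ i → i ≤ net.N → 0 < net.r i) {t : ℤ} (ht : 0 ≤ t) {k : ℕ} (h1 : 1 ≤ k)
    (hk : k ≤ net.N) (n : ℕ) :
    net.aggregate w k (t + net.σ k + (n + 1 : ℕ)) = net.aggregate w k (t + net.σ k + n)
        + ((net.data d w t k).transit n + (net.data d w t k).shifted n)
        - net.costate w (t + net.σ k + n) / net.ρ k ∧
      net.γ k * net.aggregate w k (t + net.σ k + (n + 1 : ℕ))
        = net.costate w (t + net.σ k + n) - net.costate w (t + net.σ k + (n + 1 : ℕ)) := by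
  have e1 : t + net.σ k + (n + 1 : ℕ) = t + net.σ k + n + 1 := by push_cast; ring
  rw [e1]
  refine ⟨?_, hw.aggregate_eq hq h1 hk (by omega)⟩
  rw [hw.aggregate_dynamics hr h1 hk (by omega)]
  congr 2
  simp only [data]
  congr 1
  -- For node N the delays `τ` and `τ'` may differ, but they only enter through the flow u_N = 0.
  rcases hk.eq_or_lt with rfl | hlt
  · simp only [hw.no_flow_last]
  · rw [τ', if_neg hlt.ne]
    congr 1
    ring

/-! ### Sweeping through the windows of the nodes -/

theorem exists_node_feedforward (hw : net.IsExtremal d w)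
    (hq : ∀ i, 1 ≤ i → i ≤ net.N → 0 < net.q i)
    (hr : ∀ i, 1 ≤ i → i ≤ net.N → 0 < net.r i) {t : ℤ} (ht : 0 ≤ t) {k : ℕ} (h1 : 1 ≤ k)
    (hk : k ≤ net.N) {f : ℝ}
    (hT : net.costate w (t + net.σ k + net.τ' k)
      = net.costToGo k (net.τ' k + 1) * (net.aggregate w k (t + net.σ k + net.τ' k) + f)) :
    ∃ F : ℕ → ℝ, F (net.τ' k) = f ∧
      (∀ n ≤ net.τ' k, net.costate w (t + net.σ k + n)
        = net.costToGo k (n + 1) * (net.aggregate w k (t + net.σ k + n) + F n)) ∧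
      ∀ n < net.τ' k, F n = (net.data d w t k).transit n + (net.data d w t k).shifted n
        + net.costToGo k (n + 2) / (net.costToGo k (n + 2) + net.γ k) * F (n + 1) :=
  exists_feedforward (net.ρ_pos hr h1 hk) (net.γ_pos hq h1 hk)
    (m := fun n => net.aggregate w k (t + net.σ k + n))
    (l := fun n => net.costate w (t + net.σ k + n))
    (e := fun n => (net.data d w t k).transit n + (net.data d w t k).shifted n)
    (fun _ _ _ => net.costToGo_pos hq hr _ h1 hk)
    (fun _ _ hj => net.costToGo_step hk hj)
    (fun n _ => (hw.node_recursion hq hr ht h1 hk n).1)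
    (fun n _ => (hw.node_recursion hq hr ht h1 hk n).2) hT

theorem prod_g_eq {k n : ℕ} (hn : n ≤ net.τ' k) :
    ∏ j ∈ Finset.Icc 2 n, net.g k j
      = ∏ j ∈ Finset.Icc 2 n, net.costToGo k j / (net.costToGo k j + net.γ k) := by
  refine Finset.prod_congr rfl fun j hj => ?_
  obtain ⟨hj1, hj2⟩ := Finset.mem_Icc.1 hj
  exact net.g_eq hj1 (by omega)

/-- At the start of the window the aggregate splits as m_k + z_{k+1}[t]; this level together with
the unrolled feedforward is the downstream message. -/
theorem costate_node_start_of_end (hw : net.IsExtremal d w)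
    (hq : ∀ i, 1 ≤ i → i ≤ net.N → 0 < net.q i)
    (hr : ∀ i, 1 ≤ i → i ≤ net.N → 0 < net.r i)
    (hτ : ∀ i, 1 ≤ i → i < net.N → 1 ≤ net.τ i)
    {t : ℤ} (ht : 0 ≤ t) {k : ℕ} (hk : k + 1 ≤ net.N)
    (hT : net.costate w (t + net.σ (k + 1) + net.τ' (k + 1))
      = net.costToGo (k + 1) (net.τ' (k + 1) + 1)
        * (net.aggregate w (k + 1) (t + net.σ (k + 1) + net.τ' (k + 1))
          + net.μ d w t (k + 1 + 1))) :
    net.costate w (t + net.σ (k + 1)) = net.X (k + 1) 1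
      * (net.aggregate w k (t + net.σ (k + 1)) + net.μ d w t (k + 1)) := by
  obtain ⟨F, hF1, hF2, hF3⟩ := hw.exists_node_feedforward hq hr ht (by omega) (by omega) hT
  have h3 := hF2 0 (by omega)
  have h4 := net.τ'_pos hτ (i := k + 1) (by omega) (by omega)
  rw [Nat.cast_zero, add_zero, zero_add, aggregate_succ, net.costToGo_of_le h4,
    show t + net.σ (k + 1) - net.σ (k + 1) = t by ring] at h3
  rw [h3, add_assoc]
  congr 2
  rw [μ, if_neg (by omega)]
  have h5 := feedforward_expansion
    (e := fun n => (net.data d w t (k + 1)).transit n + (net.data d w t (k + 1)).shifted n)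
    (g := fun j => net.costToGo (k + 1) j / (net.costToGo (k + 1) j + net.γ (k + 1)))
    hF3 _ le_rfl
  rw [h5, hF1]
  simp only [NodeParams.downMessage, NodeParams.π, params]
  rw [← add_assoc]
  congr 1
  · congr 1
    refine Finset.sum_congr rfl fun Δ hΔ => ?_
    rw [prod_g_eq (by have := Finset.mem_range.1 hΔ; omega)]
  -- At node N the incoming message is zero, so b_N plays no role. Otherwise the last factor of the
  -- product is g_{k+2}(1).
  · rcases hk.eq_or_lt with h6 | h6
    · rw [μ, if_pos (by omega)]
      simp
    · rw [b, net.g_succ_one h6, prod_g_eq le_rfl, Finset.prod_Icc_succ_top (by omega)]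
      ring

theorem costate_node_end (hw : net.IsExtremal d w) (hN : 1 ≤ net.N)
    (hq : ∀ i, 1 ≤ i → i ≤ net.N → 0 < net.q i)
    (hr : ∀ i, 1 ≤ i → i ≤ net.N → 0 < net.r i)
    (hτ : ∀ i, 1 ≤ i → i < net.N → 1 ≤ net.τ i)
    (hd : ∀ i, 1 ≤ i → i ≤ net.N → ∀ t : ℤ,
      (net.H : ℤ) + ((net.σ net.N : ℤ) - (net.σ i : ℤ)) < t → d i t = 0)
    {t : ℤ} (ht : 0 ≤ t) {k : ℕ} (h1 : 1 ≤ k) (hk : k ≤ net.N) :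
    net.costate w (t + net.σ k + net.τ' k) = net.costToGo k (net.τ' k + 1)
      * (net.aggregate w k (t + net.σ k + net.τ' k) + net.μ d w t (k + 1)) := by
  induction hk using Nat.decreasingInduction with
  | self =>
    -- With τ_N = H + 1 the last window ends just beyond the horizon, even for t = 0.
    have h2 : net.τ' net.N = net.H + 1 := if_pos rfl
    rw [μ, if_pos (by omega), add_zero, h2]
    exact hw.costate_eq_of_horizon hN hq hr hd (by push_cast; omega)
  | of_succ k hk ih =>
    have hτk : net.τ' k = net.τ k := if_neg hk.ne
    have e1 : t + net.σ k + net.τ' k = t + net.σ (k + 1) := by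
      rw [net.σ_succ h1, hτk]; push_cast; ring
    rw [e1, net.costToGo_succ hk]
    exact hw.costate_node_start_of_end hq hr hτ ht hk (ih (by omega))

theorem costate_node_start (hw : net.IsExtremal d w) (hN : 1 ≤ net.N)
    (hq : ∀ i, 1 ≤ i → i ≤ net.N → 0 < net.q i)
    (hr : ∀ i, 1 ≤ i → i ≤ net.N → 0 < net.r i)
    (hτ : ∀ i, 1 ≤ i → i < net.N → 1 ≤ net.τ i)
    (hd : ∀ i, 1 ≤ i → i ≤ net.N → ∀ t : ℤ,
      (net.H : ℤ) + ((net.σ net.N : ℤ) - (net.σ i : ℤ)) < t → d i t = 0)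
    {t : ℤ} (ht : 0 ≤ t) {k : ℕ} (hk : k + 1 ≤ net.N) :
    net.costate w (t + net.σ (k + 1)) = net.X (k + 1) 1
      * (net.aggregate w k (t + net.σ (k + 1)) + net.μ d w t (k + 1)) :=
  hw.costate_node_start_of_end hq hr hτ ht hk
    (hw.costate_node_end hN hq hr hτ hd ht (by omega) hk)

theorem μ_eq {t : ℤ} {k : ℕ} (hk : k ≤ net.N) : net.μ d w t k
    = w.z k t + ∑ Δ ∈ Finset.range (net.τ' k),
        ((net.data d w t k).transit Δ + (net.data d w t k).shifted Δ)
          * ∏ j ∈ Finset.Icc 2 (Δ + 1), net.g k j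
      + net.b k * net.μ d w t (k + 1) := by
  rw [μ, if_neg (by omega)]
  rfl

/-- The upstream message predicts the aggregate level at the end of the delay of a node. -/
theorem aggregate_node_end (hw : net.IsExtremal d w) (hN : 1 ≤ net.N)
    (hq : ∀ i, 1 ≤ i → i ≤ net.N → 0 < net.q i)
    (hr : ∀ i, 1 ≤ i → i ≤ net.N → 0 < net.r i)
    (hτ : ∀ i, 1 ≤ i → i < net.N → 1 ≤ net.τ i)
    (hd : ∀ i, 1 ≤ i → i ≤ net.N → ∀ t : ℤ,
      (net.H : ℤ) + ((net.σ net.N : ℤ) - (net.σ i : ℤ)) < t → d i t = 0)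
    {t : ℤ} (ht : 0 ≤ t) {k : ℕ} (hk : k < net.N) :
    net.aggregate w k (t + net.σ (k + 1)) = net.δ d w t k - net.h k * net.μ d w t (k + 1) := by
  induction k with
  | zero => simp [aggregate, δ, h]
  | succ k ih =>
    have hτk : net.τ' (k + 1) = net.τ (k + 1) := if_neg hk.ne
    have hτ1 := net.τ'_pos hτ (i := k + 1) (by omega) (by omega)
    obtain ⟨F, hF1, hF2, hF3⟩ := hw.exists_node_feedforward hq hr ht (k := k + 1) (by omega)
      (by omega) (hw.costate_node_end hN hq hr hτ hd ht (by omega) (by omega))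
    have e1 : t + net.σ (k + 1 + 1) = t + net.σ (k + 1) + net.τ' (k + 1) := by
      rw [net.σ_succ (k := k + 1) (by omega), hτk]; push_cast; ring
    obtain ⟨T, hT⟩ := Nat.exists_eq_add_of_le' hτ1
    have key := level_expansion (T := net.τ' (k + 1))
      (x := net.costToGo (k + 1)) (ρ := net.ρ (k + 1))
      (m := fun n => net.aggregate w (k + 1) (t + net.σ (k + 1) + n))
      (l := fun n => net.costate w (t + net.σ (k + 1) + n))
      (e := fun n => (net.data d w t (k + 1)).transit n + (net.data d w t (k + 1)).shifted n)
      (g := fun j => net.costToGo (k + 1) j / (net.costToGo (k + 1) j + net.γ (k + 1)))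
      (P := net.P (k + 1))
      (fun n _ => (hw.node_recursion hq hr ht (by omega) (by omega) n).1)
      (fun n hn => hF2 n hn.le) hF3
      (fun j => by rw [net.costToGo_of_le hτ1, P])
      (fun n j hn hj => by simp only [← net.g_eq (show 2 ≤ n + 2 by omega) hn]
                           rw [P, if_pos hj, net.costToGo_of_le hn])
      (fun n j hn hj => by rw [P, if_neg (by omega), net.costToGo_of_le hn]) T (by omega)
    -- Unfolding μ_{k+1} inside δ_k - h_k μ_{k+1} produces the h-term of φ from its local part, and
    -- the first term of the recursion for h from its message part.
    have hm := net.aggregate_succ w k (t + net.σ (k + 1))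
    rw [show t + net.σ (k + 1) - net.σ (k + 1) = t by ring, ih (by omega),
      μ_eq (by omega : k + 1 ≤ net.N)] at hm
    have hg := net.g_succ_one hk
    simp only [show T + 2 = net.τ' (k + 1) + 1 by omega, ← hT, ← hg, hF1, Nat.cast_zero,
      add_zero] at key
    rw [e1, key, hm, net.h_eq (i := k + 1) (by omega)]
    simp only [δ, NodeParams.upMessage, NodeParams.Φ, params, φ, Nat.add_sub_cancel]
    have hsum : ∑ Δ ∈ Finset.range (net.τ' (k + 1)),
        (1 - net.P (k + 1) (net.τ' (k + 1)) (Δ + 1)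
          - (1 - net.P (k + 1) (net.τ' (k + 1)) 1) * net.h k
            * ∏ j ∈ Finset.Icc 2 (Δ + 1), net.g (k + 1) j)
          * ((net.data d w t (k + 1)).transit Δ + (net.data d w t (k + 1)).shifted Δ)
        = ∑ Δ ∈ Finset.range (net.τ' (k + 1)), (1 - net.P (k + 1) (net.τ' (k + 1)) (Δ + 1))
          * ((net.data d w t (k + 1)).transit Δ + (net.data d w t (k + 1)).shifted Δ)
        - (1 - net.P (k + 1) (net.τ' (k + 1)) 1) * net.h k
          * ∑ Δ ∈ Finset.range (net.τ' (k + 1)),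
            ((net.data d w t (k + 1)).transit Δ + (net.data d w t (k + 1)).shifted Δ)
              * ∏ j ∈ Finset.Icc 2 (Δ + 1), net.g (k + 1) j := by
      rw [Finset.mul_sum, ← Finset.sum_sub_distrib]
      exact Finset.sum_congr rfl fun Δ _ => by ring
    rw [hsum]
    have hz : (net.data d w t (k + 1)).z = w.z (k + 1) t := rfl
    rw [hz, Finset.Icc_eq_empty (show ¬ 2 ≤ 1 by omega), Finset.prod_empty]
    ring

/-- An extremal trajectory is generated by the distributed controller. -/
theorem isControlled (hw : net.IsExtremal d w) (hN : 1 ≤ net.N)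
    (hq : ∀ i, 1 ≤ i → i ≤ net.N → 0 < net.q i)
    (hr : ∀ i, 1 ≤ i → i ≤ net.N → 0 < net.r i)
    (hτ : ∀ i, 1 ≤ i → i < net.N → 1 ≤ net.τ i)
    (hd : ∀ i, 1 ≤ i → i ≤ net.N → ∀ t : ℤ,
      (net.H : ℤ) + ((net.σ net.N : ℤ) - (net.σ i : ℤ)) < t → d i t = 0) :
    net.IsControlled d w := by
  intro t ht i h1 hi
  obtain ⟨k, rfl⟩ := Nat.exists_eq_add_of_le' h1
  have hq0 := (hq _ h1 hi).ne'
  have hr0 := (hr _ h1 hi).ne'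
  have hρ0 := (net.ρ_pos hr h1 hi).ne'
  have hm := hw.aggregate_node_end hN hq hr hτ hd ht hi
  have hc := hw.costate_node_start hN hq hr hτ hd ht hi
  rw [hm] at hc
  have hv : w.v (k + 1) t = (net.params (k + 1)).production
      (net.δ d w t (k + 1 - 1)) (net.μ d w t (k + 1)) := by
    have h2 := hw.production_eq h1 hi ht
    simp only [NodeParams.production, params, Nat.add_sub_cancel]
    apply mul_left_cancel₀ hr0
    rw [h2, hc]
    field_simp
    ring
  refine ⟨?_, hv⟩
  have h3 := hw.level_eq h1 hi ht
  obtain ⟨h4, h5⟩ := hw.node_recursion hq hr ht h1 hi 0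
  have h6 := hw.dynamics (k + 1) h1 hi t ht
  have h7 : w.u (k + 1) (t - net.τ (k + 1)) = (net.data d w t (k + 1)).transit 0 := by
    rcases hi.eq_or_lt with h8 | h8
    · simp only [data, h8, hw.no_flow_last]
    · simp [data, τ', h8.ne]
  simp only [Nat.cast_zero, add_zero, zero_add, Nat.cast_one] at h4 h5
  rw [net.aggregate_succ w k (t + net.σ (k + 1)),
    show t + net.σ (k + 1) - net.σ (k + 1) = t by ring, hm, hc] at h4
  -- Both sides equal the same decrement of λ, so the next level is the share γ_i/q_i of the next
  -- aggregate; the dynamics are then solved for the flow.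
  rw [← h5, h4] at h3
  rw [hv, h7] at h6
  simp only [NodeParams.flow, NodeParams.production, params, a, c, Nat.add_sub_cancel] at h6 ⊢
  rw [h6] at h3
  have hz : (net.data d w t (k + 1)).z = w.z (k + 1) t := rfl
  have hd' : (net.data d w t (k + 1)).d = d (k + 1) t := rfl
  rw [hz, hd']
  field_simp at h3 ⊢
  linarith

end IsExtremal

/-! ### The cost -/

/-- The cost at time `t`. -/
def stageCost (w : Trajectory) (t : ℕ) : ℝ :=
  ∑ i ∈ Finset.Icc 1 net.N, (net.q i * w.z i t ^ 2 + net.r i * w.v i t ^ 2)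

theorem cost_eq_tsum (w : Trajectory) :
    net.cost w = ∑' t : ℕ, ENNReal.ofReal (net.stageCost w t) := rfl

variable {net} {d : ℕ → ℤ → ℝ} {z₀ : ℕ → ℝ} {u₀ : ℕ → ℤ → ℝ} {w w' p : Trajectory}

theorem stageCost_term_nonneg
    (hq : ∀ i, 1 ≤ i → i ≤ net.N → 0 < net.q i) (hr : ∀ i, 1 ≤ i → i ≤ net.N → 0 < net.r i)
    (w : Trajectory) (t : ℕ) :
    ∀ i ∈ Finset.Icc 1 net.N, 0 ≤ net.q i * w.z i t ^ 2 + net.r i * w.v i t ^ 2 := by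
  intro i hi
  obtain ⟨h1, h2⟩ := Finset.mem_Icc.1 hi
  have := hq i h1 h2
  have := hr i h1 h2
  positivity

theorem stageCost_nonneg
    (hq : ∀ i, 1 ≤ i → i ≤ net.N → 0 < net.q i) (hr : ∀ i, 1 ≤ i → i ≤ net.N → 0 < net.r i)
    (w : Trajectory) (t : ℕ) : 0 ≤ net.stageCost w t :=
  Finset.sum_nonneg (stageCost_term_nonneg hq hr w t)

theorem level_cost_le
    (hq : ∀ i, 1 ≤ i → i ≤ net.N → 0 < net.q i) (hr : ∀ i, 1 ≤ i → i ≤ net.N → 0 < net.r i)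
    (w : Trajectory) (t : ℕ) {i : ℕ} (h1 : 1 ≤ i) (h2 : i ≤ net.N) :
    net.q i * w.z i t ^ 2 ≤ net.stageCost w t := by
  refine le_trans ?_ (Finset.single_le_sum (stageCost_term_nonneg hq hr w t)
    (Finset.mem_Icc.2 ⟨h1, h2⟩))
  have := hr i h1 h2
  exact le_add_of_nonneg_right (by positivity)

theorem production_cost_le
    (hq : ∀ i, 1 ≤ i → i ≤ net.N → 0 < net.q i) (hr : ∀ i, 1 ≤ i → i ≤ net.N → 0 < net.r i)
    (w : Trajectory) (t : ℕ) {i : ℕ} (h1 : 1 ≤ i) (h2 : i ≤ net.N) :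
    net.r i * w.v i t ^ 2 ≤ net.stageCost w t := by
  refine le_trans ?_ (Finset.single_le_sum (stageCost_term_nonneg hq hr w t)
    (Finset.mem_Icc.2 ⟨h1, h2⟩))
  have := hq i h1 h2
  exact le_add_of_nonneg_left (by positivity)

theorem tendsto_stageCost
    (hq : ∀ i, 1 ≤ i → i ≤ net.N → 0 < net.q i) (hr : ∀ i, 1 ≤ i → i ≤ net.N → 0 < net.r i)
    (hw : net.cost w < ⊤) : Tendsto (net.stageCost w) atTop (𝓝 0) := by
  have h1 := ENNReal.tendsto_atTop_zero_of_tsum_ne_top (cost_eq_tsum net w ▸ hw.ne)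
  have h2 := (ENNReal.tendsto_toReal ENNReal.zero_ne_top).comp h1
  refine h2.congr fun t => ?_
  exact ENNReal.toReal_ofReal (stageCost_nonneg hq hr w t)

theorem stageCost_le_of_cost_le {C : ENNReal} (hC : C < ⊤) (hw : net.cost w ≤ C) (t : ℕ) :
    net.stageCost w t ≤ C.toReal := by
  have h1 : ENNReal.ofReal (net.stageCost w t) ≤ C :=
    (ENNReal.le_tsum (f := fun t => ENNReal.ofReal (net.stageCost w t)) t).trans hw
  exact (ENNReal.ofReal_le_iff_le_toReal hC.ne).1 h1

theorem tendsto_zero_of_mul_sq_le {c : ℝ} (hc : 0 < c) {x y : ℕ → ℝ}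
    (h : ∀ n, c * x n ^ 2 ≤ y n) (hy : Tendsto y atTop (𝓝 0)) : Tendsto x atTop (𝓝 0) := by
  have h1 : Tendsto (fun n => c * x n ^ 2) atTop (𝓝 0) :=
    squeeze_zero (fun n => by positivity) h hy
  have h2 : Tendsto (fun n => x n ^ 2) atTop (𝓝 0) := by
    have := h1.const_mul c⁻¹
    simpa [hc.ne'] using this
  have h3 := h2.sqrt
  simp only [Real.sqrt_sq_eq_abs, Real.sqrt_zero] at h3
  exact (tendsto_zero_iff_abs_tendsto_zero _).2 h3

/-! ### First variation of the cost -/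

/-- The trajectory `w + ε p`. -/
def perturb (w p : Trajectory) (ε : ℝ) : Trajectory where
  z i t := w.z i t + ε * p.z i t
  u i t := w.u i t + ε * p.u i t
  v i t := w.v i t + ε * p.v i t

theorem IsFeasible.perturb (hw : net.IsFeasible d z₀ u₀ w)
    (hp : net.IsFeasible (fun _ _ => 0) (fun _ => 0) (fun _ _ => 0) p) (ε : ℝ) :
    net.IsFeasible d z₀ u₀ (perturb w p ε) where
  level_init i h1 h2 := by simp [Network.perturb, hw.level_init i h1 h2, hp.level_init i h1 h2]
  transit_init i h1 h2 t h3 h4 := by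
    simp [Network.perturb, hw.transit_init i h1 h2 t h3 h4, hp.transit_init i h1 h2 t h3 h4]
  no_flow_zero t := by simp [Network.perturb, hw.no_flow_zero, hp.no_flow_zero]
  no_flow_last t := by simp [Network.perturb, hw.no_flow_last, hp.no_flow_last]
  dynamics i h1 h2 t ht := by
    have h3 := hw.dynamics i h1 h2 t ht
    have h4 := hp.dynamics i h1 h2 t ht
    simp only [Network.perturb]
    linear_combination h3 + ε * h4

/-- The common tail of the two costs is finite, so it cancels in `ENNReal`. -/
theorem IsOptimal.sum_stageCost_le
    (hq : ∀ i, 1 ≤ i → i ≤ net.N → 0 < net.q i) (hr : ∀ i, 1 ≤ i → i ≤ net.N → 0 < net.r i)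
    (hw : net.IsOptimal d z₀ u₀ w) (hfin : net.cost w < ⊤) (hw' : net.IsFeasible d z₀ u₀ w')
    {T : ℕ} (hT : ∀ t, T ≤ t → net.stageCost w' t = net.stageCost w t) :
    ∑ t ∈ Finset.range T, net.stageCost w t ≤ ∑ t ∈ Finset.range T, net.stageCost w' t := by
  have hsplit : ∀ w, net.cost w = ENNReal.ofReal (∑ t ∈ Finset.range T, net.stageCost w t)
      + ∑' t : ℕ, ENNReal.ofReal (net.stageCost w (t + T)) := by
    intro w
    rw [ENNReal.ofReal_sum_of_nonneg fun t _ => stageCost_nonneg hq hr w t, cost_eq_tsum]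
    exact (Summable.sum_add_tsum_nat_add' ENNReal.summable).symm
  have h1 := hw.2 w' hw'
  rw [hsplit w] at hfin
  rw [hsplit w, hsplit w'] at h1
  simp only [hT _ (Nat.le_add_left T _)] at h1
  have h2 := (ENNReal.add_le_add_iff_right (ENNReal.add_lt_top.1 hfin).2.ne).1 h1
  exact (ENNReal.ofReal_le_ofReal_iff
    (Finset.sum_nonneg fun t _ => stageCost_nonneg hq hr w' t)).1 h2

theorem IsOptimal.first_variation
    (hq : ∀ i, 1 ≤ i → i ≤ net.N → 0 < net.q i) (hr : ∀ i, 1 ≤ i → i ≤ net.N → 0 < net.r i)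
    (hw : net.IsOptimal d z₀ u₀ w) (hfin : net.cost w < ⊤)
    (hp : net.IsFeasible (fun _ _ => 0) (fun _ => 0) (fun _ _ => 0) p) {T : ℕ}
    (hz : ∀ i (t : ℕ), T ≤ t → p.z i t = 0) (hv : ∀ i (t : ℕ), T ≤ t → p.v i t = 0) :
    ∑ i ∈ Finset.Icc 1 net.N, ∑ t ∈ Finset.range T,
      (net.q i * w.z i t * p.z i t + net.r i * w.v i t * p.v i t) = 0 := by
  rw [Finset.sum_comm]
  set B := ∑ t ∈ Finset.range T, ∑ i ∈ Finset.Icc 1 net.N,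
    (net.q i * w.z i t * p.z i t + net.r i * w.v i t * p.v i t)
  set C := ∑ t ∈ Finset.range T, net.stageCost p t
  have hC : 0 ≤ C := Finset.sum_nonneg fun t _ => stageCost_nonneg hq hr p t
  have h1 : ∀ ε : ℝ, 0 ≤ 2 * ε * B + ε ^ 2 * C := by
    intro ε
    have h2 := hw.sum_stageCost_le hq hr hfin (hw.1.perturb hp ε) (T := T) (fun t ht => by
      simp only [stageCost, Network.perturb, hz _ t ht, hv _ t ht, mul_zero, add_zero])
    have h3 : ∑ t ∈ Finset.range T, net.stageCost (Network.perturb w p ε) t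
        = ∑ t ∈ Finset.range T, net.stageCost w t + (2 * ε * B + ε ^ 2 * C) := by
      simp only [B, C, stageCost, Finset.mul_sum, ← Finset.sum_add_distrib, Network.perturb]
      refine Finset.sum_congr rfl fun t _ => Finset.sum_congr rfl fun i _ => ?_
      ring
    linarith
  -- Close to the minimizer -B/C, but also meaningful for C = 0.
  have h2 := h1 (-B / (C + 1))
  have h3 : 2 * (-B / (C + 1)) * B + (-B / (C + 1)) ^ 2 * C
      = -(B ^ 2 * (C + 2)) / (C + 1) ^ 2 := by
    field_simp
    ring
  rw [h3, neg_div, Left.nonneg_neg_iff] at h2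
  by_contra hB
  have : 0 < B ^ 2 * (C + 2) / (C + 1) ^ 2 := by positivity
  linarith

/-- Delaying one unit of production in node `i` from time `t` to time `t + 1`, with sign. -/
def postponement (i t : ℕ) : Trajectory where
  z j s := if j = i then if s = ((t + 1 : ℕ) : ℤ) then 1 else 0 else 0
  u _ _ := 0
  v j s := if j = i then (if s = (t : ℤ) then 1 else 0) - if s = ((t + 1 : ℕ) : ℤ) then 1 else 0
    else 0

theorem isFeasible_postponement (i t : ℕ) :
    net.IsFeasible (fun _ _ => 0) (fun _ => 0) (fun _ _ => 0) (postponement i t) where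
  level_init j _ _ := by
    have : (0 : ℤ) ≠ ((t + 1 : ℕ) : ℤ) := by omega
    simp only [postponement, if_neg this, ite_self]
  transit_init _ _ _ _ _ _ := rfl
  no_flow_zero _ := rfl
  no_flow_last _ := rfl
  dynamics j _ _ s _ := by
    simp only [postponement]
    split_ifs <;> first | omega | simp

/-- Moving one unit of production from node `i` at time `t + τ i` to node `i + 1` at time `t`. -/
def relocation (net : Network) (i t : ℕ) : Trajectory where
  z _ _ := 0
  u j s := if j = i then if s = (t : ℤ) then 1 else 0 else 0
  v j s := (if j = i + 1 then if s = (t : ℤ) then 1 else 0 else 0)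
    - if j = i then if s = ((t + net.τ i : ℕ) : ℤ) then 1 else 0 else 0

theorem isFeasible_relocation {i : ℕ} (h1 : 1 ≤ i) (hi : i < net.N) (t : ℕ) :
    net.IsFeasible (fun _ _ => 0) (fun _ => 0) (fun _ _ => 0) (relocation net i t) where
  level_init _ _ _ := rfl
  transit_init j _ _ s _ _ := by
    simp only [relocation]
    split_ifs <;> first | omega | rfl
  no_flow_zero _ := if_neg (by omega)
  no_flow_last _ := if_neg (by omega)
  dynamics j hj _ s _ := by
    simp only [relocation]
    rcases eq_or_ne j i with rfl | h2
    · rw [if_neg (by omega : ¬ j - 1 = j), if_neg (by omega : ¬ j = j + 1)]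
      split_ifs <;> first | omega | simp
    · rw [if_neg h2]
      split_ifs <;> first | omega | simp

theorem IsOptimal.isExtremal
    (hq : ∀ i, 1 ≤ i → i ≤ net.N → 0 < net.q i) (hr : ∀ i, 1 ≤ i → i ≤ net.N → 0 < net.r i)
    (hw : net.IsOptimal d z₀ u₀ w) (hfin : net.cost w < ⊤) : net.IsExtremal d w where
  no_flow_zero := hw.1.no_flow_zero
  no_flow_last := hw.1.no_flow_last
  dynamics := hw.1.dynamics
  postpone i h1 hi t ht := by
    lift t to ℕ using ht
    have h2 := hw.first_variation hq hr hfin (isFeasible_postponement i t) (T := t + 2)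
      (fun j s hs => by
        simp only [postponement, Nat.cast_inj]
        split_ifs <;> first | omega | rfl)
      (fun j s hs => by
        simp only [postponement, Nat.cast_inj]
        split_ifs <;> first | omega | simp)
    rw [Finset.sum_eq_single i (fun j _ hj => by simp [postponement, hj])
      (fun h => absurd (Finset.mem_Icc.2 ⟨h1, hi⟩) h)] at h2
    simp only [postponement, if_true, Nat.cast_inj, mul_sub, mul_ite, mul_one, mul_zero,
      Finset.sum_add_distrib, Finset.sum_sub_distrib, Finset.sum_ite_eq', Finset.mem_range] at h2
    rw [if_pos (by omega), if_pos (by omega), if_pos (by omega)] at h2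
    push_cast at h2
    linarith
  relocate i h1 hi t ht := by
    lift t to ℕ using ht
    have h2 := hw.first_variation hq hr hfin (isFeasible_relocation h1 hi t)
      (T := t + net.τ i + 1) (fun j s hs => rfl)
      (fun j s hs => by
        simp only [relocation, Nat.cast_inj]
        split_ifs <;> first | omega | simp)
    simp only [relocation, Nat.cast_inj, mul_sub, mul_ite, mul_one, mul_zero, zero_add,
      Finset.sum_sub_distrib] at h2
    rw [Finset.sum_eq_single (i + 1) (fun j _ hj => by simp [hj])
        (fun h => absurd (Finset.mem_Icc.2 ⟨by omega, by omega⟩) h),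
      Finset.sum_eq_single i (fun j _ hj => by simp [hj])
        (fun h => absurd (Finset.mem_Icc.2 ⟨by omega, by omega⟩) h)] at h2
    simp only [if_true, Finset.sum_ite_eq', Finset.mem_range] at h2
    rw [if_pos (by omega), if_pos (by omega)] at h2
    push_cast at h2
    linarith
  tendsto_z i h1 hi := tendsto_zero_of_mul_sq_le (hq i h1 hi)
    (fun t => level_cost_le hq hr w t h1 hi) (tendsto_stageCost hq hr hfin)
  tendsto_v i h1 hi := tendsto_zero_of_mul_sq_le (hr i h1 hi)
    (fun t => production_cost_le hq hr w t h1 hi) (tendsto_stageCost hq hr hfin)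

/-! ### Existence of an optimal trajectory -/

/-- All levels are brought to zero in one step by production alone. -/
def deadbeat (net : Network) (d : ℕ → ℤ → ℝ) (z₀ : ℕ → ℝ) (u₀ : ℕ → ℤ → ℝ) : Trajectory :=
  let u : ℕ → ℤ → ℝ := fun i t => if 1 ≤ i ∧ i < net.N ∧ t < 0 then u₀ i t else 0
  let z : ℕ → ℤ → ℝ := fun i t => if t ≤ 0 then z₀ i else 0
  { z := z
    u := u
    v := fun i t => -z i t - u i (t - net.τ i) - d i t }

theorem isFeasible_deadbeat : net.IsFeasible d z₀ u₀ (deadbeat net d z₀ u₀) where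
  level_init i _ _ := by simp [deadbeat]
  transit_init i h1 h2 t _ h3 := by simp [deadbeat, h1, h2, h3]
  no_flow_zero t := by simp [deadbeat]
  no_flow_last t := by simp [deadbeat]
  dynamics i _ _ t ht := by
    simp only [deadbeat]
    rw [if_neg (by omega : ¬ t + 1 ≤ 0), if_neg (by omega : ¬ (1 ≤ i - 1 ∧ i - 1 < net.N ∧ t < 0))]
    ring

theorem cost_deadbeat_lt_top (hd : ∀ i, 1 ≤ i → i ≤ net.N → ∀ t : ℤ,
      (net.H : ℤ) + ((net.σ net.N : ℤ) - (net.σ i : ℤ)) < t → d i t = 0) :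
    net.cost (deadbeat net d z₀ u₀) < ⊤ := by
  rw [cost_eq_tsum, tsum_eq_sum (s := Finset.range
    (net.H + net.σ net.N + ∑ i ∈ Finset.Icc 1 net.N, net.τ i + 1))]
  · exact ENNReal.sum_lt_top.2 fun _ _ => ENNReal.ofReal_lt_top
  · intro t ht
    rw [Finset.mem_range, not_lt] at ht
    rw [stageCost, Finset.sum_eq_zero, ENNReal.ofReal_zero]
    intro i hi
    have h1 := Finset.single_le_sum (f := net.τ) (fun _ _ => Nat.zero_le _) hi
    obtain ⟨hi1, hi2⟩ := Finset.mem_Icc.1 hi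
    simp only [deadbeat]
    rw [if_neg (by omega), if_neg (by omega), hd i hi1 hi2 _ (by omega)]
    ring

/-- Along one ultrafilter all bounded coordinates converge at once, which replaces a diagonal
subsequence. -/
theorem exists_tendsto_of_mul_sq_le (𝒰 : Ultrafilter ℕ) {c C : ℝ} (hc : 0 < c) {x : ℕ → ℝ}
    (h : ∀ n, c * x n ^ 2 ≤ C) : ∃ a, Tendsto x 𝒰 (𝓝 a) := by
  have hb : ∀ n, x n ∈ Set.Icc (-(C / c + 1)) (C / c + 1) := by
    intro n
    have h1 : x n ^ 2 ≤ C / c := by rw [le_div_iff₀ hc]; linarith [h n]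
    constructor <;> nlinarith
  obtain ⟨a, _, ha⟩ := isCompact_Icc.ultrafilter_le_nhds (𝒰.map x)
    (tendsto_principal.2 (Eventually.of_forall hb))
  exact ⟨a, ha⟩

/-- The cost does not bound the flows. They converge because the dynamics of node i+1 express u_i by
levels, productions and u_{i+1}, starting from u_N = 0. -/
theorem exists_tendsto_flow (𝒰 : Ultrafilter ℕ) {W : ℕ → Trajectory}
    (hW : ∀ n, net.IsFeasible d z₀ u₀ (W n))
    (hz : ∀ i, 1 ≤ i → i ≤ net.N → ∀ t : ℤ, 0 ≤ t →
      ∃ a, Tendsto (fun n => (W n).z i t) 𝒰 (𝓝 a))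
    (hv : ∀ i, 1 ≤ i → i ≤ net.N → ∀ t : ℤ, 0 ≤ t →
      ∃ a, Tendsto (fun n => (W n).v i t) 𝒰 (𝓝 a)) {i : ℕ} (hi : i ≤ net.N) :
    ∀ t : ℤ, (i = 0 ∨ i = net.N ∨ -(net.τ i : ℤ) ≤ t) →
      ∃ a, Tendsto (fun n => (W n).u i t) 𝒰 (𝓝 a) := by
  induction hi using Nat.decreasingInduction with
  | self => exact fun t _ => ⟨0, by simpa only [(hW _).no_flow_last] using tendsto_const_nhds⟩
  | of_succ i hi ih =>
    intro t ht
    rcases Nat.eq_zero_or_pos i with rfl | h1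
    · exact ⟨0, by simpa only [(hW _).no_flow_zero] using tendsto_const_nhds⟩
    rcases lt_or_ge t 0 with h2 | h2
    · refine ⟨u₀ i t, tendsto_const_nhds.congr fun n => ?_⟩
      exact ((hW n).transit_init i h1 hi t (by omega) h2).symm
    · obtain ⟨a₁, h₁⟩ := hz (i + 1) (by omega) hi t h2
      obtain ⟨a₂, h₂⟩ := hz (i + 1) (by omega) hi (t + 1) (by omega)
      obtain ⟨a₃, h₃⟩ := ih (t - net.τ (i + 1)) (by omega)
      obtain ⟨a₄, h₄⟩ := hv (i + 1) (by omega) hi t h2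
      refine ⟨_, ((((h₁.sub h₂).add h₃).add h₄).add_const (d (i + 1) t)).congr fun n => ?_⟩
      have := (hW n).dynamics (i + 1) (by omega) hi t h2
      rw [Nat.add_sub_cancel] at this
      linarith

theorem exists_isOptimal
    (hq : ∀ i, 1 ≤ i → i ≤ net.N → 0 < net.q i) (hr : ∀ i, 1 ≤ i → i ≤ net.N → 0 < net.r i)
    (hw' : net.IsFeasible d z₀ u₀ w') (hfin : net.cost w' < ⊤) :
    ∃ w, net.IsOptimal d z₀ u₀ w ∧ net.cost w < ⊤ := by
  set S : Set ENNReal := {c | ∃ w, net.IsFeasible d z₀ u₀ w ∧ net.cost w = c ∧ c < ⊤}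
  obtain ⟨c, hc, hlim, hcS⟩ := exists_seq_tendsto_sInf (S := S) ⟨_, w', hw', rfl, hfin⟩
    (OrderBot.bddBelow S)
  choose W hW hWc hWfin using hcS
  set 𝒰 : Ultrafilter ℕ := hyperfilter ℕ
  have h𝒰 : (𝒰 : Filter ℕ) ≤ atTop := Nat.hyperfilter_le_atTop
  -- The minimizing costs decrease, so the first one bounds every stage of every trajectory.
  have hbound : ∀ n t, net.stageCost (W n) t ≤ (c 0).toReal := fun n t =>
    stageCost_le_of_cost_le (hWfin 0) ((hWc n).trans_le (hc (Nat.zero_le n))) t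
  have hz : ∀ i, 1 ≤ i → i ≤ net.N → ∀ t : ℤ, 0 ≤ t →
      ∃ a, Tendsto (fun n => (W n).z i t) 𝒰 (𝓝 a) := by
    intro i h1 hi t ht
    lift t to ℕ using ht
    exact exists_tendsto_of_mul_sq_le 𝒰 (hq i h1 hi)
      fun n => (level_cost_le hq hr (W n) t h1 hi).trans (hbound n t)
  have hv : ∀ i, 1 ≤ i → i ≤ net.N → ∀ t : ℤ, 0 ≤ t →
      ∃ a, Tendsto (fun n => (W n).v i t) 𝒰 (𝓝 a) := by
    intro i h1 hi t ht
    lift t to ℕ using ht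
    exact exists_tendsto_of_mul_sq_le 𝒰 (hr i h1 hi)
      fun n => (production_cost_le hq hr (W n) t h1 hi).trans (hbound n t)
  have hu : ∀ i, i ≤ net.N → ∀ t : ℤ, (i = 0 ∨ i = net.N ∨ -(net.τ i : ℤ) ≤ t) →
      ∃ a, Tendsto (fun n => (W n).u i t) 𝒰 (𝓝 a) := fun i hi =>
    exists_tendsto_flow 𝒰 hW hz hv hi
  choose! z hz using hz
  choose! v hv using hv
  choose! u hu using hu
  set w : Trajectory := ⟨z, u, v⟩
  have hw : net.IsFeasible d z₀ u₀ w := by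
    refine ⟨fun i h1 hi => ?_, fun i h1 hi t h2 h3 => ?_, fun t => ?_, fun t => ?_,
      fun i h1 hi t ht => ?_⟩
    · refine tendsto_nhds_unique (hz i h1 hi 0 le_rfl) (tendsto_const_nhds.congr fun n => ?_)
      exact ((hW n).level_init i h1 hi).symm
    · refine tendsto_nhds_unique (hu i hi.le t (by omega)) (tendsto_const_nhds.congr fun n => ?_)
      exact ((hW n).transit_init i h1 hi t h2 h3).symm
    · refine tendsto_nhds_unique (hu 0 (Nat.zero_le _) t (by omega))
        (tendsto_const_nhds.congr fun n => ?_)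
      exact ((hW n).no_flow_zero t).symm
    · refine tendsto_nhds_unique (hu net.N le_rfl t (by omega))
        (tendsto_const_nhds.congr fun n => ?_)
      exact ((hW n).no_flow_last t).symm
    · have h3 := ((((hz i h1 hi t ht).sub (hu (i - 1) (by omega) t (by omega))).add
        (hu i hi (t - net.τ i) (by omega))).add (hv i h1 hi t ht)).add_const (d i t)
      refine tendsto_nhds_unique (hz i h1 hi (t + 1) (by omega)) (h3.congr fun n => ?_)
      exact ((hW n).dynamics i h1 hi t ht).symm
  have hstage : ∀ t, Tendsto (fun n => net.stageCost (W n) t) 𝒰 (𝓝 (net.stageCost w t)) := by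
    intro t
    refine tendsto_finsetSum _ fun i hi => ?_
    obtain ⟨h1, h2⟩ := Finset.mem_Icc.1 hi
    exact (((hz i h1 h2 t (by omega)).pow 2).const_mul _).add
      (((hv i h1 h2 t (by omega)).pow 2).const_mul _)
  have hle : net.cost w ≤ sInf S := by
    rw [cost_eq_tsum]
    -- Lower semicontinuity: each finite partial sum passes to the limit and is bounded by the full
    -- costs.
    refine ENNReal.tsum_le_of_sum_range_le fun T => ?_
    refine le_of_tendsto_of_tendsto' (tendsto_finsetSum _ fun t _ =>
      (ENNReal.continuous_ofReal.tendsto _).comp (hstage t)) (hlim.mono_left h𝒰) fun n => ?_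
    rw [← hWc n]
    exact ENNReal.sum_le_tsum _
  refine ⟨w, ⟨hw, fun w'' hw'' => ?_⟩, (hle.trans (sInf_le ⟨w', hw', rfl, hfin⟩)).trans_lt hfin⟩
  rcases eq_or_ne (net.cost w'') ⊤ with h | h
  · rw [h]; exact le_top
  · exact hle.trans (sInf_le ⟨w'', hw'', rfl, h.lt_top⟩)

/-! ### The controller determines the trajectory -/

/-- The information on the network that the controller uses at time `t` agrees. -/
def SameData (net : Network) (d : ℕ → ℤ → ℝ) (w w' : Trajectory) (t : ℤ) : Prop :=
  ∀ i, 1 ≤ i → i ≤ net.N → w.z i t = w'.z i t ∧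
    ∀ Δ < net.τ' i, (net.data d w t i).transit Δ = (net.data d w' t i).transit Δ

theorem SameData.δ_eq {t : ℤ} (h : net.SameData d w w' t) {i : ℕ} (hi : i ≤ net.N) :
    net.δ d w t i = net.δ d w' t i := by
  induction i with
  | zero => rfl
  | succ i ih =>
    obtain ⟨h1, h2⟩ := h (i + 1) (by omega) hi
    simp only [δ, NodeParams.upMessage, NodeParams.Φ, ih (by omega)]
    congr 2
    · simp only [data, h1]
    · refine Finset.sum_congr rfl fun Δ hΔ => ?_
      rw [h2 Δ (Finset.mem_range.1 hΔ)]
      rfl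

theorem SameData.μ_eq {t : ℤ} (h : net.SameData d w w' t) {i : ℕ} (h1 : 1 ≤ i)
    (hi : i ≤ net.N + 1) : net.μ d w t i = net.μ d w' t i := by
  induction hi using Nat.decreasingInduction with
  | self => rw [μ, if_pos (by omega), μ, if_pos (by omega)]
  | of_succ i hi ih =>
    obtain ⟨h2, h3⟩ := h i h1 (by omega)
    rw [IsExtremal.μ_eq (k := i) (w := w) (by omega), IsExtremal.μ_eq (k := i) (w := w') (by omega),
      ih (by omega), h2]
    congr 2
    refine Finset.sum_congr rfl fun Δ hΔ => ?_
    rw [h3 Δ (Finset.mem_range.1 hΔ)]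
    rfl

theorem SameData.inputs_eq (hτ : ∀ i, 1 ≤ i → i < net.N → 1 ≤ net.τ i)
    (hc : net.IsControlled d w) (hc' : net.IsControlled d w') {t : ℤ} (ht : 0 ≤ t)
    (h : net.SameData d w w' t) {i : ℕ} (h1 : 1 ≤ i) (hi : i ≤ net.N) :
    w.u (i - 1) t = w'.u (i - 1) t ∧ w.v i t = w'.v i t := by
  obtain ⟨h2, h3⟩ := hc t ht i h1 hi
  obtain ⟨h4, h5⟩ := hc' t ht i h1 hi
  obtain ⟨h6, h7⟩ := h i h1 hi
  have h8 := h7 0 (net.τ'_pos hτ h1 hi)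
  have h9 : (net.data d w t i).z = (net.data d w' t i).z := h6
  rw [h2, h3, h4, h5, h.δ_eq (by omega), h.μ_eq h1 (by omega)]
  refine ⟨?_, rfl⟩
  simp only [NodeParams.flow, h8, h9]
  rfl

/-- Induction on time, jointly for the levels at time t and all flows sent before t. -/
theorem sameData_of_isControlled (hτ : ∀ i, 1 ≤ i → i < net.N → 1 ≤ net.τ i)
    (hw : net.IsFeasible d z₀ u₀ w) (hw' : net.IsFeasible d z₀ u₀ w')
    (hc : net.IsControlled d w) (hc' : net.IsControlled d w') (t : ℕ) :
    net.SameData d w w' t := by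
  have hsame : ∀ t : ℤ, (∀ i, 1 ≤ i → i ≤ net.N → w.z i t = w'.z i t) →
      (∀ i, 1 ≤ i → i < net.N → ∀ s : ℤ, -(net.τ i : ℤ) ≤ s → s < t → w.u i s = w'.u i s) →
      0 ≤ t → net.SameData d w w' t := by
    intro t hz hu ht i h1 hi
    refine ⟨hz i h1 hi, fun Δ hΔ => ?_⟩
    rcases hi.eq_or_lt with h2 | h2
    · simp only [data, h2, hw.no_flow_last, hw'.no_flow_last]
    · have h3 : net.τ' i = net.τ i := if_neg h2.ne
      exact hu i h1 h2 _ (by omega) (by omega)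
  have key : ∀ t : ℕ, (∀ i, 1 ≤ i → i ≤ net.N → w.z i t = w'.z i t) ∧
      ∀ i, 1 ≤ i → i < net.N → ∀ s : ℤ, -(net.τ i : ℤ) ≤ s → s < t → w.u i s = w'.u i s := by
    intro t
    induction t with
    | zero =>
      refine ⟨fun i h1 hi => ?_, fun i h1 hi s h2 h3 => ?_⟩
      · exact (hw.level_init i h1 hi).trans (hw'.level_init i h1 hi).symm
      · exact (hw.transit_init i h1 hi s h2 h3).trans (hw'.transit_init i h1 hi s h2 h3).symm
    | succ t ih =>
      have h := hsame t ih.1 ih.2 (by omega)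
      have hin := fun {i} => h.inputs_eq hτ hc hc' (by omega) (i := i)
      refine ⟨fun i h1 hi => ?_, fun i h1 hi s h2 h3 => ?_⟩
      · push_cast
        rw [hw.dynamics i h1 hi t (by omega), hw'.dynamics i h1 hi t (by omega),
          (hin h1 hi).1, (hin h1 hi).2, ih.1 i h1 hi]
        rcases hi.eq_or_lt with h2 | h2
        · simp only [h2, hw.no_flow_last, hw'.no_flow_last]
        -- As τ_i ≥ 1, what arrives now was sent strictly earlier.
        · rw [ih.2 i h1 h2 _ (by omega) (by have := hτ i h1 h2; omega)]
      · rcases eq_or_ne s t with rfl | h4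
        · exact (hin (i := i + 1) (by omega) hi).1
        · exact ih.2 i h1 hi s h2 (by omega)
  exact hsame t (key t).1 (key t).2 (by omega)

theorem cost_eq_of_isControlled (hτ : ∀ i, 1 ≤ i → i < net.N → 1 ≤ net.τ i)
    (hw : net.IsFeasible d z₀ u₀ w) (hw' : net.IsFeasible d z₀ u₀ w')
    (hc : net.IsControlled d w) (hc' : net.IsControlled d w') : net.cost w = net.cost w' := by
  refine tsum_congr fun t => ?_
  congr 1
  refine Finset.sum_congr rfl fun i hi => ?_
  obtain ⟨h1, h2⟩ := Finset.mem_Icc.1 hi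
  have h := sameData_of_isControlled hτ hw hw' hc hc' t
  rw [(h i h1 h2).1, (h.inputs_eq hτ hc hc' (by omega) h1 h2).2]

end Network

end TransportLQ

theorem theorem1 (net : TransportLQ.Network) (hN : 1 ≤ net.N)
    (hq : ∀ i, 1 ≤ i → i ≤ net.N → 0 < net.q i)
    (hr : ∀ i, 1 ≤ i → i ≤ net.N → 0 < net.r i)
    (hτ : ∀ i, 1 ≤ i → i < net.N → 1 ≤ net.τ i)
    (d : ℕ → ℤ → ℝ)
    (hd : ∀ i, 1 ≤ i → i ≤ net.N → ∀ t : ℤ,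
      (net.H : ℤ) + ((net.σ net.N : ℤ) - (net.σ i : ℤ)) < t → d i t = 0)
    (z₀ : ℕ → ℝ) (u₀ : ℕ → ℤ → ℝ) :
    (∃ w, net.IsOptimal d z₀ u₀ w ∧ net.cost w < ⊤) ∧
    ∀ w, net.IsOptimal d z₀ u₀ w ↔ (net.IsFeasible d z₀ u₀ w ∧ net.IsControlled d w) := by
  obtain ⟨w₀, hopt, hfin⟩ := TransportLQ.Network.exists_isOptimal (net := net) (u₀ := u₀) hq hr
    TransportLQ.Network.isFeasible_deadbeat (TransportLQ.Network.cost_deadbeat_lt_top (z₀ := z₀) hd)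
  refine ⟨⟨w₀, hopt, hfin⟩, fun w => ⟨fun hw => ⟨hw.1, ?_⟩, fun ⟨hw, hc⟩ => ⟨hw, fun w' hw' => ?_⟩⟩⟩
  · exact (hw.isExtremal hq hr ((hw.2 w₀ hopt.1).trans_lt hfin)).isControlled hN hq hr hτ hd
  · rw [TransportLQ.Network.cost_eq_of_isControlled hτ hw hopt.1 hc
      ((hopt.isExtremal hq hr hfin).isControlled hN hq hr hτ hd)]
    exact hopt.2 w' hw'
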